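/- Let $(X,d)$ be a complete metric space equipped with a Borel measure $\mu$ that is doubling (balls have positive finite measure and $\mu(B(x,2r))\le C_D\,\mu(B(x,r))$ for all $x\in X$, $r>0$) and supports a $2$-Poincaré inequality: there are constants $C_P,\lambda\ge 1$ with $$\frac1{\mu(B)}\int_B|f-f_B|\,d\mu\le C_P\,\mathrm{rad}(B)\Big(\frac1{\mu(\lambda B)}\int_{\lambda B}g^2\,d\mu\Big)^{1/2},\qquad f_B:=\frac1{\mu(B)}\int_Bf\,d\mu,$$ for all balls $B$, all $f:X\to\mathbb R$ integrable on balls and all upper gradients $g$ of $f$. Here a Borel function $g:X\to[0,\infty]$ is an upper gradient of $f$ if $|f(\gamma(b))-f(\gamma(a))|\le\int_\gamma g\,ds$ for every rectifiable curve $\gamma:[a,b]\to X$. Let $N^{1,2}(X)$ be the space of measurable $f:X\to\mathbb R$ with $\big(\int_X|f|^2d\mu\big)^{1/2}+\inf_g\big(\int_Xg^2d\mu\big)^{1/2}<\infty$, the infimum being over all upper gradients $g$ of $f$. For $E\subset X$ let $\mathrm{Cap}_2(E)=\inf_f\big(\int_X|f|^2d\mu+\inf_g\int_Xg^2d\mu\big)$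 over measurable $f$ with $f\ge1$ on $E$ and upper gradients $g$ of $f$. Let $\Omega\subset X$ be a bounded domain (nonempty, open, connected) with $\mu(X\setminus\Omega)>0$, and let $N^{1,2}_0(\Omega)$ be the set of $f\in N^{1,2}(X)$ with $\mathrm{Cap}_2(\{x\in X\setminus\Omega: f(x)\neq0\})=0$. For $r>0$ let $X_r$ be a maximal $r$-separated subset of $X$ (distinct points have distance at least $r$). For distinct $\bar x,\bar y\in X_r$ write $\bar x\sim\bar y$ if $d(\bar x,\bar y)\le3r$. Let $\mu_r$ be the measure on $X_r$ with $\mu_r(\{\bar x\})=\mu(B(\bar x,r/4))$, and write $L^2(X_r)=L^2(X_r,\mu_r)$. For $v\in L^1_{loc}(X)$ put $v_r(\bar x)=\frac1{\mu(B(\bar x,r/4))}\int_{B(\bar x,r/4)}v\,d\mu$. Let $\Omega_r=\{\bar x\in X_r: B(\bar x,20r)\subset\Omega\}$, and let $D^{1,2}_0(\Omega_r)$ be the set of all $u:X_r\to\mathbb R$ with $u=0$ on $X_r\setminus\Omega_r$. Then there is a constant $C\ge1$ such that for every $r>0$ and every maximal $r$-separated set $X_r\subset X$ there is a map $P_r$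 from functions $X_r\to\mathbb R$ to functions $X\to\mathbb R$ that maps $L^2(X_r)$ into $N^{1,2}(X)$ and satisfies: (a) for every $u:X_r\to\mathbb R$, $P_ru$ is locally integrable and $(P_ru)_r(\bar x)=u(\bar x)$ for all $\bar x\in X_r$; (b) for every $u:X_r\to\mathbb R$, $$\inf_g\int_Xg^2\,d\mu\le C\sum_{\bar x\in X_r}\ \sum_{\bar y\in X_r,\ \bar y\sim\bar x}\frac{|u(\bar y)-u(\bar x)|^2}{r^2}\,\mu_r(\{\bar x\}),$$ the infimum being over all upper gradients $g$ of $P_ru$; the same bound holds for $\int_Xg_{P_ru}^2\,d\mu$ when $g_{P_ru}$ is a minimal $2$-weak upper gradient of $P_ru$, that is, a $2$-weak upper gradient in $L^2(X)$ (the upper gradient inequality holds outside a family of curves of zero $2$-modulus) that is $\mu$-a.e. at most every other $2$-weak upper gradient of $P_ru$ in $L^2(X)$; (c) $P_ru\in N^{1,2}_0(\Omega)$ for every $u\in D^{1,2}_0(\Omega_r)$. -/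

import Mathlib

open MeasureTheory Set
open scoped ENNReal

noncomputable section

namespace GraphApprox

/-! ### Curves, line integrals and upper gradients -/

/-- A rectifiable curve in `X`: a continuous map on a compact interval `[a, b]` with finite length.
Only the values of `toFun` on `[a, b]` matter. -/
structure RectCurve (X : Type*) [MetricSpace X] where
  toFun : ℝ → X
  a : ℝ
  b : ℝ
  le : a ≤ b
  continuousOn : ContinuousOn toFun (Icc a b)
  rectifiable : eVariationOn toFun (Icc a b) ≠ ∞

namespace RectCurve

variable {X : Type*} [MetricSpace X]

/-- The length of a rectifiable curve. -/
def length (γ : RectCurve X) : ℝ := (eVariationOn γ.toFun (Icc γ.a γ.b)).toReal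

/-- The arc-length parametrization `[0, length γ] → X` of a rectifiable curve. -/
def arcLength (γ : RectCurve X) : ℝ → X :=
  naturalParameterization γ.toFun (Icc γ.a γ.b) γ.a

/-- The line integral `∫_γ g ds`, computed in the arc-length parametrization. -/
def lineIntegral (γ : RectCurve X) (g : X → ℝ≥0∞) : ℝ≥0∞ :=
  ∫⁻ t in Icc 0 γ.length, g (γ.arcLength t)

end RectCurve

/-- The upper gradient inequality `|f(γ(b)) - f(γ(a))| ≤ ∫_γ g ds` for one curve. -/
def UpperGradientIneq {X : Type*} [MetricSpace X] (f : X → ℝ) (g : X → ℝ≥0∞)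
    (γ : RectCurve X) : Prop :=
  ENNReal.ofReal |f (γ.toFun γ.b) - f (γ.toFun γ.a)| ≤ γ.lineIntegral g

/-- `g : X → [0, ∞]` is an upper gradient of `f : X → ℝ`. -/
def IsUpperGradient {X : Type*} [MetricSpace X] [MeasurableSpace X]
    (f : X → ℝ) (g : X → ℝ≥0∞) : Prop :=
  Measurable g ∧ ∀ γ : RectCurve X, UpperGradientIneq f g γ

/-- The `p`-modulus of a family of curves. -/
def modulus {X : Type*} [MetricSpace X] [MeasurableSpace X] (p : ℝ) (μ : Measure X)
    (Γ : Set (RectCurve X)) : ℝ≥0∞ :=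
  ⨅ (ρ : X → ℝ≥0∞) (_ : Measurable ρ ∧ ∀ γ ∈ Γ, 1 ≤ γ.lineIntegral ρ), ∫⁻ x, ρ x ^ p ∂μ

/-- `g` is a `p`-weak upper gradient of `f`: the upper gradient inequality holds for all curves
outside a family of zero `p`-modulus. -/
def IsWeakUpperGradient {X : Type*} [MetricSpace X] [MeasurableSpace X] (p : ℝ) (μ : Measure X)
    (f : X → ℝ) (g : X → ℝ≥0∞) : Prop :=
  Measurable g ∧ ∃ Γ : Set (RectCurve X), modulus p μ Γ = 0 ∧
    ∀ γ : RectCurve X, γ ∉ Γ → UpperGradientIneq f g γ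

/-- `g` is a minimal `p`-weak upper gradient of `f`: it lies in `L^p` and is almost everywhere
at most any other `p`-weak upper gradient of `f` in `L^p`. -/
def IsMinimalWeakUpperGradient {X : Type*} [MetricSpace X] [MeasurableSpace X] (p : ℝ)
    (μ : Measure X) (f : X → ℝ) (g : X → ℝ≥0∞) : Prop :=
  IsWeakUpperGradient p μ f g ∧ ∫⁻ x, g x ^ p ∂μ < ∞ ∧
    ∀ h : X → ℝ≥0∞, IsWeakUpperGradient p μ f h → ∫⁻ x, h x ^ p ∂μ < ∞ → ∀ᵐ x ∂μ, g x ≤ h x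

/-- The upper gradient energy `inf_g ∫ g^p dμ`, the infimum being over all upper gradients. -/
def upperGradientEnergy {X : Type*} [MetricSpace X] [MeasurableSpace X] (p : ℝ) (μ : Measure X)
    (f : X → ℝ) : ℝ≥0∞ :=
  ⨅ (g : X → ℝ≥0∞) (_ : IsUpperGradient f g), ∫⁻ x, g x ^ p ∂μ

/-! ### Newton-Sobolev spaces -/

/-- The norm of `N^{1,p}(X)`, with values in `[0, ∞]`. -/
def newtonSobolevNorm {X : Type*} [MetricSpace X] [MeasurableSpace X] (p : ℝ) (μ : Measure X)
    (f : X → ℝ) : ℝ≥0∞ :=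
  (∫⁻ x, ENNReal.ofReal |f x| ^ p ∂μ) ^ (1 / p) +
    ⨅ (g : X → ℝ≥0∞) (_ : IsUpperGradient f g), (∫⁻ x, g x ^ p ∂μ) ^ (1 / p)

/-- `f ∈ N^{1,p}(X)`. -/
def MemNewtonSobolev {X : Type*} [MetricSpace X] [MeasurableSpace X] (p : ℝ) (μ : Measure X)
    (f : X → ℝ) : Prop :=
  AEMeasurable f μ ∧ newtonSobolevNorm p μ f < ∞

/-- The Sobolev `p`-capacity of a set. -/
def capacity {X : Type*} [MetricSpace X] [MeasurableSpace X] (p : ℝ) (μ : Measure X)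
    (E : Set X) : ℝ≥0∞ :=
  ⨅ (f : X → ℝ) (_ : AEMeasurable f μ ∧ ∀ x ∈ E, 1 ≤ f x),
    (∫⁻ x, ENNReal.ofReal |f x| ^ p ∂μ) + upperGradientEnergy p μ f

/-- `f ∈ N^{1,p}_0(Ω)`: `f ∈ N^{1,p}(X)` and `f = 0` on `X \ Ω` outside a set of zero
`p`-capacity. -/
def MemNewtonSobolevZero {X : Type*} [MetricSpace X] [MeasurableSpace X] (p : ℝ) (μ : Measure X)
    (Ω : Set X) (f : X → ℝ) : Prop :=
  MemNewtonSobolev p μ f ∧ capacity p μ {x | x ∉ Ω ∧ f x ≠ 0} = 0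

/-! ### Doubling measures and Poincaré inequalities -/

/-- `μ` is a doubling measure: balls have positive finite measure, and
`μ(B(x, 2r)) ≤ C_D μ(B(x, r))` for all balls. -/
def IsDoubling {X : Type*} [MetricSpace X] [MeasurableSpace X] (μ : Measure X) : Prop :=
  (∀ (x : X) (r : ℝ), 0 < r → 0 < μ (Metric.ball x r) ∧ μ (Metric.ball x r) < ∞) ∧
    ∃ CD : ℝ, 1 ≤ CD ∧ ∀ (x : X) (r : ℝ), 0 < r →
      μ (Metric.ball x (2 * r)) ≤ ENNReal.ofReal CD * μ (Metric.ball x r)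

/-- `(X, d, μ)` supports a `p`-Poincaré inequality. The functions are integrable on balls, so that
their averages make sense. -/
def SupportsPoincare {X : Type*} [MetricSpace X] [MeasurableSpace X] (p : ℝ)
    (μ : Measure X) : Prop :=
  ∃ CP lam : ℝ, 1 ≤ CP ∧ 1 ≤ lam ∧
    ∀ (f : X → ℝ) (g : X → ℝ≥0∞),
      (∀ (x : X) (r : ℝ), 0 < r → IntegrableOn f (Metric.ball x r) μ) → IsUpperGradient f g →
      ∀ (x : X) (r : ℝ), 0 < r →
        (⨍⁻ y in Metric.ball x r,
            ENNReal.ofReal |f y - ⨍ z in Metric.ball x r, f z ∂μ| ∂μ) ≤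
          ENNReal.ofReal (CP * r) *
            (⨍⁻ y in Metric.ball x (lam * r), g y ^ p ∂μ) ^ (1 / p)

/-! ### Graph approximations -/

/-- `A` is `r`-separated: distinct points of `A` have distance at least `r`. -/
def IsSeparatedSet {X : Type*} [MetricSpace X] (r : ℝ) (A : Set X) : Prop :=
  ∀ x ∈ A, ∀ y ∈ A, x ≠ y → r ≤ dist x y

/-- `A` is a maximal `r`-separated set, that is, a discretization of `X` at scale `r`. -/
def IsDiscretization {X : Type*} [MetricSpace X] (r : ℝ) (A : Set X) : Prop :=
  Maximal (IsSeparatedSet r) A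

/-- The graph with vertex set `A` in which distinct `x, y` are neighbors if `d(x, y) ≤ 3r`. -/
def proximityGraph {X : Type*} [MetricSpace X] (r : ℝ) (A : Set X) : SimpleGraph A where
  Adj x y := x ≠ y ∧ dist (x : X) (y : X) ≤ 3 * r
  symm := ⟨fun _ _ h => ⟨h.1.symm, dist_comm (α := X) _ _ ▸ h.2⟩⟩
  loopless := ⟨fun _ h => h.1 rfl⟩

/-- The measure `μ_r` on the vertex set `A`, with `μ_r({x}) = μ(B(x, r/4))`. -/
def discreteMeasure {X : Type*} [MetricSpace X] [MeasurableSpace X] (μ : Measure X) (r : ℝ)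
    (A : Set X) : Measure A :=
  Measure.sum fun x : A => μ (Metric.ball (x : X) (r / 4)) • Measure.dirac x

/-- The ball average `v_r(x) = ⨍_{B(x, r/4)} v dμ` for `x ∈ A`. -/
def ballAverage {X : Type*} [MetricSpace X] [MeasurableSpace X] (μ : Measure X) (r : ℝ)
    (A : Set X) (v : X → ℝ) (x : A) : ℝ :=
  ⨍ y in Metric.ball (x : X) (r / 4), v y ∂μ

/-- The graph energy `∑_x ∑_{y ∼ x} |u(y) - u(x)|² / r² μ_r({x})`, with values in `[0, ∞]`. -/
def graphEnergy {X : Type*} [MetricSpace X] [MeasurableSpace X] (μ : Measure X) (r : ℝ)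
    (A : Set X) (u : A → ℝ) : ℝ≥0∞ :=
  ∑' x : A, ∑' y : (proximityGraph r A).neighborSet x,
    ENNReal.ofReal (|u y - u x| ^ 2 / r ^ 2) * discreteMeasure μ r A {x}

/-- The discretization `Ω_r` of `Ω`: the vertices `x` with `B(x, 20r) ⊆ Ω`. -/
def discreteDomain {X : Type*} [MetricSpace X] (r : ℝ) (A : Set X) (Ω : Set X) : Set A :=
  {x | Metric.ball (x : X) (20 * r) ⊆ Ω}

/-- `u ∈ D^{1,2}_0(Ω_r)`: `u` vanishes at the vertices outside `Ω_r`. -/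
def MemDiscreteZero {X : Type*} [MetricSpace X] (r : ℝ) (A : Set X) (Ω : Set X)
    (u : A → ℝ) : Prop :=
  ∀ x : A, x ∉ discreteDomain r A Ω → u x = 0

end GraphApprox

end

/-!
`P_r u` interpolates `u` by a Lipschitz partition of unity whose functions other than that of `x`
vanish on `B(x, r/4)`, so that `P_r u = u x` there. On `B(x, 3r/2)` the function `P_r u` is a convex
combination of the values of `u` at the boundedly many vertices within `3r` of `x`, with weights of
Lipschitz constant comparable to `1/r`; hence its Lipschitz constant there is at most a constant
times the largest difference quotient of `u` over the neighbors of `x`. The supremum of these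
bounds over the balls containing a point is an upper gradient, and integrating its square against
the doubling measure `μ` gives a multiple of the graph energy.
-/

namespace GraphApprox

open Filter Metric Topology
open scoped NNReal

section Curves

lemma continuousOn_variationOnFromTo {α E : Type*} [LinearOrder α] [TopologicalSpace α]
    [OrderTopology α] [PseudoMetricSpace E] {f : α → E} {s : Set α}
    (hf : LocallyBoundedVariationOn f s) (hc : ContinuousOn f s) {a : α} (ha : a ∈ s) :
    ContinuousOn (variationOnFromTo f s a) s := by
  intro b hb
  have hl := variationOnFromTo.tendsto_left ha hb hf ((hc b hb).mono inter_subset_left)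
  have hr := variationOnFromTo.tendsto_right ha hb hf ((hc b hb).mono inter_subset_left)
  rw [dist_self, sub_zero] at hl
  rw [dist_self, add_zero] at hr
  rw [← continuousWithinAt_sdiff_self, sdiff_eq, ← Iio_union_Ioi, inter_union_distrib_left]
  exact ContinuousWithinAt.union hl hr

lemma lipschitzOnWith_of_hasUnitSpeedOn {E : Type*} [PseudoEMetricSpace E] {f : ℝ → E} {s : Set ℝ}
    (h : HasUnitSpeedOn f s) : LipschitzOnWith 1 f s := by
  intro x hx y hy
  wlog hxy : x ≤ y generalizing x y
  · simpa only [edist_comm] using this hy hx (le_of_not_ge hxy)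
  calc edist (f x) (f y) ≤ eVariationOn f (s ∩ Icc x y) :=
        eVariationOn.edist_le _ ⟨hx, left_mem_Icc.2 hxy⟩ ⟨hy, right_mem_Icc.2 hxy⟩
    _ = ENNReal.ofReal (y - x) := by simpa only [NNReal.coe_one, one_mul] using h hx hy
    _ = (1 : ℝ≥0) * edist x y := by
        rw [ENNReal.coe_one, one_mul, edist_comm, edist_dist, Real.dist_eq,
          abs_of_nonneg (sub_nonneg.2 hxy)]

namespace RectCurve

variable {X : Type*} [MetricSpace X] (γ : RectCurve X)

lemma length_nonneg : 0 ≤ γ.length := ENNReal.toReal_nonneg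

lemma locallyBoundedVariationOn : LocallyBoundedVariationOn γ.toFun (Icc γ.a γ.b) :=
  BoundedVariationOn.locallyBoundedVariationOn γ.rectifiable

lemma variationOnFromTo_right : variationOnFromTo γ.toFun (Icc γ.a γ.b) γ.a γ.b = γ.length := by
  rw [variationOnFromTo.eq_of_le _ _ γ.le, inter_self, length]

lemma arcLength_zero : γ.arcLength 0 = γ.toFun γ.a := by
  have h := edist_naturalParameterization_eq_zero γ.locallyBoundedVariationOn
    (left_mem_Icc.2 γ.le) (left_mem_Icc.2 γ.le)
  rw [variationOnFromTo.self] at h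
  exact edist_eq_zero.1 h

lemma arcLength_length : γ.arcLength γ.length = γ.toFun γ.b := by
  have h := edist_naturalParameterization_eq_zero γ.locallyBoundedVariationOn
    (left_mem_Icc.2 γ.le) (right_mem_Icc.2 γ.le)
  rw [variationOnFromTo_right] at h
  exact edist_eq_zero.1 h

lemma Icc_subset_image_variationOnFromTo :
    Icc 0 γ.length ⊆ variationOnFromTo γ.toFun (Icc γ.a γ.b) γ.a '' Icc γ.a γ.b := by
  have h := intermediate_value_Icc γ.le (continuousOn_variationOnFromTo
    γ.locallyBoundedVariationOn γ.continuousOn (left_mem_Icc.2 γ.le))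
  rwa [variationOnFromTo.self, variationOnFromTo_right] at h

lemma lipschitzOnWith_arcLength : LipschitzOnWith 1 γ.arcLength (Icc 0 γ.length) :=
  (lipschitzOnWith_of_hasUnitSpeedOn (has_unit_speed_naturalParameterization γ.toFun
    γ.locallyBoundedVariationOn (left_mem_Icc.2 γ.le))).mono γ.Icc_subset_image_variationOnFromTo

end RectCurve

section LocallyLipschitz

variable {X Y : Type*} [PseudoEMetricSpace X] [PseudoEMetricSpace Y] {f : X → Y} {g : X → ℝ≥0∞}
  {σ : ℝ → X} {a b : ℝ}

lemma edist_comp_le_setLIntegral_of_lipschitzOnWith {c : ℝ≥0} {U : Set X} (hab : a ≤ b)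
    (hσ : LipschitzOnWith 1 σ (Icc a b)) (hU : MapsTo σ (Icc a b) U)
    (hf : LipschitzOnWith c f U) (hg : ∀ p ∈ U, c ≤ g p) :
    edist (f (σ a)) (f (σ b)) ≤ ∫⁻ t in Ioc a b, g (σ t) :=
  calc edist (f (σ a)) (f (σ b)) ≤ (c * 1 : ℝ≥0) * edist a b :=
        hf.comp hσ hU (left_mem_Icc.2 hab) (right_mem_Icc.2 hab)
    _ = ∫⁻ _ in Ioc a b, c := by
        rw [setLIntegral_const, Real.volume_Ioc, mul_one, edist_comm, edist_dist, Real.dist_eq,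
          abs_of_nonneg (sub_nonneg.2 hab)]
    _ ≤ ∫⁻ t in Ioc a b, g (σ t) :=
        setLIntegral_mono' measurableSet_Ioc fun t ht => hg _ (hU (Ioc_subset_Icc_self ht))

lemma edist_comp_le_setLIntegral (hab : a ≤ b) (hσ : LipschitzOnWith 1 σ (Icc a b))
    (h : ∀ z, ∃ c : ℝ≥0, ∃ U ∈ 𝓝 z, LipschitzOnWith c f U ∧ ∀ p ∈ U, c ≤ g p) :
    edist (f (σ a)) (f (σ b)) ≤ ∫⁻ t in Ioc a b, g (σ t) := by
  choose c U hU hf hg using h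
  have hopen (z : X) : IsOpen ((Icc a b).domRestrict σ ⁻¹' interior (U z)) :=
    isOpen_interior.preimage hσ.continuousOn.domRestrict
  have hcover : univ ⊆ ⋃ z, (Icc a b).domRestrict σ ⁻¹' interior (U z) := fun t _ =>
    mem_iUnion.2 ⟨σ t, mem_interior_iff_mem_nhds.2 (hU (σ t))⟩
  obtain ⟨t, ht0, htmono, ⟨m, hm⟩, ht⟩ :=
    exists_monotone_Icc_subset_open_cover_Icc hab hopen hcover
  have hstep (n : ℕ) : edist (f (σ (t n))) (f (σ (t (n + 1)))) ≤
      ∫⁻ s in Ioc (t n : ℝ) (t (n + 1)), g (σ s) := by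
    obtain ⟨z, hz⟩ := ht n
    have hsub : Icc (t n : ℝ) (t (n + 1)) ⊆ Icc a b := Icc_subset_Icc (t n).2.1 (t (n + 1)).2.2
    exact edist_comp_le_setLIntegral_of_lipschitzOnWith (htmono n.le_succ) (hσ.mono hsub)
      (fun s hs => interior_subset (@hz ⟨s, hsub hs⟩ hs)) (hf z) (hg z)
  have hpartial (n : ℕ) : edist (f (σ a)) (f (σ (t n))) ≤ ∫⁻ s in Ioc a (t n), g (σ s) := by
    induction n with
    | zero => simp [ht0]
    | succ n ih =>
      calc edist (f (σ a)) (f (σ (t (n + 1))))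
          ≤ edist (f (σ a)) (f (σ (t n))) + edist (f (σ (t n))) (f (σ (t (n + 1)))) :=
            edist_triangle _ _ _
        _ ≤ (∫⁻ s in Ioc a (t n), g (σ s)) + ∫⁻ s in Ioc (t n : ℝ) (t (n + 1)), g (σ s) :=
            add_le_add ih (hstep n)
        _ = ∫⁻ s in Ioc a (t (n + 1)), g (σ s) := by
            rw [← lintegral_union measurableSet_Ioc (Ioc_disjoint_Ioc_of_le le_rfl),
              Ioc_union_Ioc_eq_Ioc (t n).2.1 (htmono n.le_succ)]
  simpa only [hm m le_rfl] using hpartial m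

end LocallyLipschitz

lemma upperGradientIneq_of_locallyLipschitz {X : Type*} [MetricSpace X] {f : X → ℝ} {g : X → ℝ≥0∞}
    (h : ∀ z, ∃ c : ℝ≥0, ∃ U ∈ 𝓝 z, LipschitzOnWith c f U ∧ ∀ p ∈ U, c ≤ g p)
    (γ : RectCurve X) : UpperGradientIneq f g γ := by
  rw [UpperGradientIneq, ← Real.dist_eq, ← edist_dist, edist_comm, ← γ.arcLength_zero,
    ← γ.arcLength_length]
  exact (edist_comp_le_setLIntegral γ.length_nonneg γ.lipschitzOnWith_arcLength h).trans
    (lintegral_mono_set Ioc_subset_Icc_self)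

end Curves

section Doubling

variable {X : Type*} [MetricSpace X] {r : ℝ} {A : Set X}

lemma IsDiscretization.exists_dist_lt (hA : IsDiscretization r A) (hr : 0 < r) (z : X) :
    ∃ x : A, dist (x : X) z < r := by
  by_contra! h
  have hs : IsSeparatedSet r (insert z A) := by
    rintro x (rfl | hx) y (rfl | hy) hxy
    · exact absurd rfl hxy
    · exact (h ⟨y, hy⟩).trans_eq (dist_comm _ _)
    · exact h ⟨x, hx⟩
    · exact hA.prop x hx y hy hxy
  have hz : z ∈ A := hA.2 hs (subset_insert z A) (mem_insert z A)
  exact (h ⟨z, hz⟩).not_gt (by rwa [dist_self])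

lemma IsSeparatedSet.pairwise_disjoint_ball (hA : IsSeparatedSet r A) :
    Pairwise (Function.onFun Disjoint fun x : A => ball (x : X) (r / 4)) := by
  intro x y hxy
  rcases le_or_gt r 0 with hr | hr
  · simp only [Function.onFun, ball_eq_empty.2 (show r / 4 ≤ 0 by linarith), disjoint_empty]
  · have hdist := hA x x.2 y y.2 (Subtype.coe_injective.ne hxy)
    exact ball_disjoint_ball (by linarith)

variable [MeasurableSpace X] {μ : Measure X} {D : ℝ≥0}

/-- The measure `μ` is doubling with the explicit constant `D`, in terms of which the estimates
below are uniform in the scale and in the separated set. -/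
structure IsDoublingWith (μ : Measure X) (D : ℝ≥0) : Prop where
  measure_ball_pos (x : X) {r : ℝ} (hr : 0 < r) : 0 < μ (ball x r)
  measure_ball_lt_top (x : X) {r : ℝ} (hr : 0 < r) : μ (ball x r) < ∞
  measure_ball_two_mul_le (x : X) {r : ℝ} (hr : 0 < r) : μ (ball x (2 * r)) ≤ D * μ (ball x r)

lemma IsDoubling.exists_isDoublingWith (hμ : IsDoubling μ) : ∃ D, IsDoublingWith μ D := by
  obtain ⟨hball, D, -, hD⟩ := hμ
  exact ⟨D.toNNReal, fun x _ hr => (hball x _ hr).1, fun x _ hr => (hball x _ hr).2,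
    fun x _ hr => hD x _ hr⟩

namespace IsDoublingWith

lemma isLocallyFiniteMeasure (hμ : IsDoublingWith μ D) : IsLocallyFiniteMeasure μ :=
  ⟨fun x => ⟨ball x 1, ball_mem_nhds x one_pos, hμ.measure_ball_lt_top x one_pos⟩⟩

lemma measure_ball_le_pow_mul (hμ : IsDoublingWith μ D) (n : ℕ) (x : X) {R : ℝ} (hr : 0 < r)
    (hR : R ≤ 2 ^ n * r) : μ (ball x R) ≤ D ^ n * μ (ball x r) := by
  induction n generalizing R with
  | zero =>
    rw [pow_zero, one_mul] at hR ⊢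
    exact measure_mono (ball_subset_ball hR)
  | succ n ih =>
    calc μ (ball x R) ≤ μ (ball x (2 * (2 ^ n * r))) :=
          measure_mono (ball_subset_ball (hR.trans_eq (by ring)))
      _ ≤ D * μ (ball x (2 ^ n * r)) := hμ.measure_ball_two_mul_le x (by positivity)
      _ ≤ D * (D ^ n * μ (ball x r)) := by gcongr; exact ih le_rfl
      _ = D ^ (n + 1) * μ (ball x r) := by rw [pow_succ', mul_assoc]

end IsDoublingWith

namespace IsSeparatedSet

variable [OpensMeasurableSpace X]

lemma card_le (hA : IsSeparatedSet r A) (hμ : IsDoublingWith μ D) (hr : 0 < r) {z : X} {R : ℝ}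
    {T : Finset A} (hT : ∀ y ∈ T, dist (y : X) z < R) {n : ℕ}
    (hn : 2 * R + r / 4 ≤ 2 ^ n * (r / 4)) : (T.card : ℝ≥0) ≤ D ^ n := by
  rcases T.eq_empty_or_nonempty with rfl | ⟨y₀, hy₀⟩
  · simp
  have hR : 0 < R := dist_nonneg.trans_lt (hT y₀ hy₀)
  set m := μ (ball z (R + r / 4))
  have hm₀ : m ≠ 0 := (hμ.measure_ball_pos z (by positivity)).ne'
  have hm₁ : m ≠ ∞ := (hμ.measure_ball_lt_top z (by positivity)).ne
  have hle (y : A) (hy : y ∈ T) : m ≤ D ^ n * μ (ball (y : X) (r / 4)) :=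
    (measure_mono (ball_subset_ball' (by linarith [hT y hy, dist_comm (y : X) z]))).trans
      (hμ.measure_ball_le_pow_mul n y (by positivity) hn)
  have hsub : ⋃ y ∈ T, ball (y : X) (r / 4) ⊆ ball z (R + r / 4) :=
    iUnion₂_subset fun y hy => ball_subset_ball' (by linarith [hT y hy])
  have hmul : T.card * m ≤ D ^ n * m := by
    calc T.card * m = ∑ _y ∈ T, m := by rw [Finset.sum_const, nsmul_eq_mul]
      _ ≤ ∑ y ∈ T, D ^ n * μ (ball (y : X) (r / 4)) := Finset.sum_le_sum hle
      _ = D ^ n * μ (⋃ y ∈ T, ball (y : X) (r / 4)) := by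
          rw [← Finset.mul_sum, measure_biUnion_finset
            (fun x _ y _ hxy => hA.pairwise_disjoint_ball hxy) fun _ _ => measurableSet_ball]
      _ ≤ D ^ n * m := mul_le_mul_right (measure_mono hsub) _
  exact_mod_cast (ENNReal.mul_le_mul_iff_left hm₀ hm₁).1 hmul

lemma finite_dist_lt (hA : IsSeparatedSet r A) (hμ : IsDoublingWith μ D) (hr : 0 < r) (z : X)
    (R : ℝ) : {y : A | dist (y : X) z < R}.Finite := by
  obtain ⟨n, hn⟩ := pow_unbounded_of_one_lt ((2 * R + r / 4) / (r / 4)) one_lt_two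
  obtain ⟨N, hN⟩ := exists_nat_gt (D ^ n)
  by_contra hinf
  obtain ⟨T, hT, rfl⟩ := Set.Infinite.exists_subset_card_eq hinf N
  exact hN.not_ge (hA.card_le hμ hr (fun y hy => hT hy) ((div_lt_iff₀ (by positivity)).1 hn).le)

lemma countable (hA : IsSeparatedSet r A) (hμ : IsDoublingWith μ D) (hr : 0 < r) :
    Countable A := by
  rcases isEmpty_or_nonempty X with _ | ⟨⟨z⟩⟩
  · infer_instance
  have hcover : (⋃ n : ℕ, {y : A | dist (y : X) z < n}) = univ :=
    iUnion_eq_univ_iff.2 fun y => exists_nat_gt (dist (y : X) z)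
  rw [← countable_univ_iff, ← hcover]
  exact countable_iUnion fun n => (hA.finite_dist_lt hμ hr z n).countable

end IsSeparatedSet

lemma discreteMeasure_singleton [MeasurableSingletonClass X] (μ : Measure X) (r : ℝ) (A : Set X)
    (x : A) : discreteMeasure μ r A {x} = μ (ball (x : X) (r / 4)) := by
  rw [discreteMeasure, Measure.sum_apply _ (measurableSet_singleton x), tsum_eq_single x]
  · simp
  · intro y hy
    simp [hy]

lemma lintegral_discreteMeasure [MeasurableSingletonClass X] (μ : Measure X) (r : ℝ) (A : Set X)
    (F : A → ℝ≥0∞) :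
    ∫⁻ x, F x ∂discreteMeasure μ r A = ∑' x : A, F x * μ (ball (x : X) (r / 4)) := by
  simp_rw [discreteMeasure, lintegral_sum_measure, lintegral_smul_measure, lintegral_dirac,
    smul_eq_mul, mul_comm]

end Doubling

section VertexSup

variable {X : Type*} [MetricSpace X] {r R : ℝ} {A : Set X} {F : A → ℝ≥0∞} {z : X}

/-- The supremum at `z` of the values of `F` at the vertices at distance less than `R` from `z`; it
carries a discrete upper gradient, or the modulus of a discrete function, over to the space. -/
noncomputable def vertexSup (R : ℝ) (F : A → ℝ≥0∞) (z : X) : ℝ≥0∞ :=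
  ⨆ x : A, (ball (x : X) R).indicator (fun _ => F x) z

lemma le_vertexSup (F : A → ℝ≥0∞) {x : A} (hz : dist z x < R) : F x ≤ vertexSup R F z :=
  le_iSup_of_le x (indicator_of_mem (mem_ball.2 hz) fun _ => F x).ge

lemma vertexSup_le {c : ℝ≥0∞} (h : ∀ x : A, dist z x < R → F x ≤ c) : vertexSup R F z ≤ c :=
  iSup_le fun x => indicator_apply_le' (h x) fun _ => zero_le

lemma measurable_vertexSup [MeasurableSpace X] [OpensMeasurableSpace X] (R : ℝ) (F : A → ℝ≥0∞) :
    Measurable (vertexSup R F) :=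
  (lowerSemicontinuous_iSup fun _ =>
    isOpen_ball.lowerSemicontinuous_indicator zero_le).measurable

lemma iSup_rpow_le_tsum {ι : Type*} (a : ι → ℝ≥0∞) {p : ℝ} (hp : 0 < p) :
    (⨆ i, a i) ^ p ≤ ∑' i, a i ^ p := by
  rw [← ENNReal.le_rpow_inv_iff hp]
  exact iSup_le fun i => (ENNReal.le_rpow_inv_iff hp).2 (ENNReal.le_tsum i)

lemma lintegral_vertexSup_rpow_le [MeasurableSpace X] [OpensMeasurableSpace X]
    {μ : Measure X} {D : ℝ≥0} [Countable A] (hμ : IsDoublingWith μ D) (hr : 0 < r) {n : ℕ}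
    (hR : R ≤ 2 ^ n * (r / 4)) (F : A → ℝ≥0∞) {p : ℝ} (hp : 0 < p) :
    ∫⁻ z, vertexSup R F z ^ p ∂μ ≤ D ^ n * ∫⁻ x, F x ^ p ∂discreteMeasure μ r A :=
  calc ∫⁻ z, vertexSup R F z ^ p ∂μ
      ≤ ∫⁻ z, ∑' x : A, (ball (x : X) R).indicator (fun _ => F x) z ^ p ∂μ :=
        lintegral_mono fun z => iSup_rpow_le_tsum _ hp
    _ = ∫⁻ z, ∑' x : A, (ball (x : X) R).indicator (fun _ => F x ^ p) z ∂μ := by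
        refine lintegral_congr fun z => tsum_congr fun x => ?_
        by_cases hz : z ∈ ball (x : X) R <;> simp [hz, hp]
    _ = ∑' x : A, F x ^ p * μ (ball (x : X) R) := by
        rw [lintegral_tsum fun x => (measurable_const.indicator measurableSet_ball).aemeasurable]
        simp_rw [lintegral_indicator_const measurableSet_ball]
    _ ≤ ∑' x : A, D ^ n * (F x ^ p * μ (ball (x : X) (r / 4))) := by
        refine ENNReal.tsum_le_tsum fun x => ?_
        rw [mul_left_comm]
        gcongr
        exact hμ.measure_ball_le_pow_mul n x (by positivity) hR
    _ = D ^ n * ∫⁻ x, F x ^ p ∂discreteMeasure μ r A := by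
        rw [lintegral_discreteMeasure, ENNReal.tsum_mul_left]

end VertexSup

section GraphSlope

variable {X : Type*} [MetricSpace X] {r : ℝ} {A : Set X} {u : A → ℝ} {x y : A}

/-- The largest difference quotient `|u y - u x| / r` of `u` over the neighbors `y` of `x`; a
discrete upper gradient. -/
noncomputable def graphSlope (r : ℝ) (A : Set X) (u : A → ℝ) (x : A) : ℝ≥0∞ :=
  ⨆ y : (proximityGraph r A).neighborSet x, ENNReal.ofReal (|u y - u x| / r)

lemma ofReal_le_graphSlope (u : A → ℝ) (h : dist (y : X) x ≤ 3 * r) :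
    ENNReal.ofReal (|u y - u x| / r) ≤ graphSlope r A u x := by
  rcases eq_or_ne x y with rfl | hxy
  · simp
  · exact le_iSup (fun y : (proximityGraph r A).neighborSet x => ENNReal.ofReal (|u y - u x| / r))
      ⟨y, hxy, by rwa [dist_comm]⟩

lemma lintegral_graphSlope_sq_le [MeasurableSpace X] [MeasurableSingletonClass X] (μ : Measure X)
    (hr : 0 ≤ r) (u : A → ℝ) :
    ∫⁻ x, graphSlope r A u x ^ (2 : ℝ) ∂discreteMeasure μ r A ≤ graphEnergy μ r A u := by
  rw [lintegral_discreteMeasure, graphEnergy]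
  refine ENNReal.tsum_le_tsum fun x => ?_
  rw [ENNReal.tsum_mul_right, discreteMeasure_singleton]
  gcongr
  refine (iSup_rpow_le_tsum _ two_pos).trans_eq (tsum_congr fun y => ?_)
  rw [ENNReal.rpow_two, ← ENNReal.ofReal_pow (by positivity), div_pow]

lemma vertexSup_graphSlope_le (hr : 0 < r) (u : A → ℝ) (z : X) :
    vertexSup (3 * r / 2) (graphSlope r A u) z ≤
      2 / ENNReal.ofReal r * vertexSup (5 * r) (fun x => ‖u x‖ₑ) z := by
  refine vertexSup_le fun x hx => iSup_le fun y => ?_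
  have hxy : dist (x : X) (y : A) ≤ 3 * r := y.2.2
  have hx' : ‖u x‖ₑ ≤ vertexSup (5 * r) (fun x => ‖u x‖ₑ) z :=
    le_vertexSup (fun x => ‖u x‖ₑ) (by linarith)
  have hy' : ‖u y‖ₑ ≤ vertexSup (5 * r) (fun x => ‖u x‖ₑ) z :=
    le_vertexSup (fun x => ‖u x‖ₑ) (by linarith [dist_triangle z x (y : A)])
  calc ENNReal.ofReal (|u y - u x| / r) = ‖u y - u x‖ₑ / ENNReal.ofReal r := by
        rw [ENNReal.ofReal_div_of_pos hr, Real.enorm_eq_ofReal_abs]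
    _ ≤ (‖u y‖ₑ + ‖u x‖ₑ) / ENNReal.ofReal r := by gcongr; exact enorm_sub_le
    _ ≤ 2 * vertexSup (5 * r) (fun x => ‖u x‖ₑ) z / ENNReal.ofReal r := by
        rw [two_mul]; gcongr
    _ = _ := ENNReal.mul_div_right_comm

end GraphSlope

lemma norm_centerMass_sub_centerMass_le {ι E : Type*} [SeminormedAddCommGroup E]
    [NormedSpace ℝ E] {t : Finset ι} {a b : ι → ℝ} {v : ι → E} {m δ M : ℝ} (hm : 0 < m)
    (ha : m ≤ ∑ i ∈ t, a i) (hb : ∀ i ∈ t, 0 ≤ b i) (hbt : 0 < ∑ i ∈ t, b i)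
    (hab : ∀ i ∈ t, |a i - b i| ≤ δ) (hv : ∀ i ∈ t, ∀ j ∈ t, ‖v i - v j‖ ≤ M) :
    ‖t.centerMass a v - t.centerMass b v‖ ≤ t.card * (δ * M) / m := by
  set c := t.centerMass b v
  have hc (i : ι) (hi : i ∈ t) : ‖v i - c‖ ≤ M := by
    have : c ∈ closedBall (v i) M := (convex_closedBall (v i) M).centerMass_mem hb hbt
      fun j hj => mem_closedBall_iff_norm.2 (hv j hj i hi)
    exact mem_closedBall_iff_norm'.1 this
  have hbc : ∑ i ∈ t, b i • (v i - c) = 0 := by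
    simp only [smul_sub, Finset.sum_sub_distrib, ← Finset.sum_smul, c, Finset.centerMass,
      smul_inv_smul₀ hbt.ne', sub_self]
  have hac : t.centerMass a v - c = (∑ i ∈ t, a i)⁻¹ • ∑ i ∈ t, (a i - b i) • (v i - c) := by
    simp only [sub_smul (a _), Finset.sum_sub_distrib, hbc, sub_zero]
    simp only [smul_sub, Finset.sum_sub_distrib, ← Finset.sum_smul,
      inv_smul_smul₀ (hm.trans_le ha).ne', Finset.centerMass]
  have hsum : ‖∑ i ∈ t, (a i - b i) • (v i - c)‖ ≤ t.card * (δ * M) := by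
    rw [← nsmul_eq_mul, ← Finset.sum_const]
    refine norm_sum_le_of_le t fun i hi => ?_
    rw [norm_smul, Real.norm_eq_abs]
    exact mul_le_mul (hab i hi) (hc i hi) (norm_nonneg _) ((abs_nonneg _).trans (hab i hi))
  rw [hac, norm_smul, norm_inv, Real.norm_of_nonneg (hm.le.trans ha), inv_mul_eq_div]
  exact div_le_div₀ ((norm_nonneg _).trans hsum) hsum hm ha

section Extension

variable {X : Type*} [MetricSpace X] {r : ℝ} {A : Set X} {u : A → ℝ} {z : X} {T : Finset A}

/-- The weight of the vertex `y` at `z` in the partition of unity subordinate to a discretization,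
before normalization. Measuring `dist y z` against `infDist z A` makes every vertex other than `x`
have weight zero on `ball x (r / 4)`, so that extended functions are constant there. -/
noncomputable def vertexWeight (r : ℝ) (A : Set X) (y z : X) : ℝ :=
  max 0 (infDist z A + r / 4 - dist y z)

/-- The operator `P_r`, which extends `u : A → ℝ` to the whole space by the partition of unity with
weights `vertexWeight`. For a discretization of a doubling space the sums are finite and the first
one is positive; otherwise `∑ᶠ` and `⁻¹` may take the junk value `0`. -/
noncomputable def extension (r : ℝ) (A : Set X) (u : A → ℝ) (z : X) : ℝ :=
  (∑ᶠ y : A, vertexWeight r A y z)⁻¹ * ∑ᶠ y : A, vertexWeight r A y z * u y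

lemma vertexWeight_nonneg (r : ℝ) (A : Set X) (y z : X) : 0 ≤ vertexWeight r A y z :=
  le_max_left _ _

lemma dist_lt_infDist_add_of_vertexWeight_ne_zero {y : X} (h : vertexWeight r A y z ≠ 0) :
    dist y z < infDist z A + r / 4 := by
  contrapose! h
  exact max_eq_left (by linarith)

lemma abs_vertexWeight_sub_le (r : ℝ) (A : Set X) (y z z' : X) :
    |vertexWeight r A y z - vertexWeight r A y z'| ≤ 2 * dist z z' := by
  have hinf : |infDist z A - infDist z' A| ≤ dist z z' := by
    simpa [Real.dist_eq] using (lipschitz_infDist_pt A).dist_le_mul z z'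
  have hdist : |dist y z' - dist y z| ≤ dist z z' := by
    simpa only [dist_comm] using abs_dist_sub_le z' z y
  refine (abs_max_sub_max_le_max _ _ _ _).trans (max_le (by simp) ?_)
  rw [abs_le] at *
  constructor <;> linarith [hinf.1, hinf.2, hdist.1, hdist.2]

lemma extension_eq_centerMass (hT : ∀ y : A, vertexWeight r A y z ≠ 0 → y ∈ T) :
    extension r A u z = T.centerMass (fun y => vertexWeight r A y z) u := by
  rw [extension, finsum_eq_sum_of_support_subset _ hT,
    finsum_eq_sum_of_support_subset _ fun y hy => hT y (left_ne_zero_of_mul hy)]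
  rfl

lemma IsDiscretization.dist_lt_of_vertexWeight_ne_zero (hA : IsDiscretization r A) (hr : 0 < r)
    {y : X} (h : vertexWeight r A y z ≠ 0) : dist y z < 5 * r / 4 := by
  obtain ⟨x, hx⟩ := hA.exists_dist_lt hr z
  rw [dist_comm] at hx
  linarith [dist_lt_infDist_add_of_vertexWeight_ne_zero h, infDist_le_dist_of_mem x.2 (x := z)]

lemma IsDiscretization.le_sum_vertexWeight (hA : IsDiscretization r A) (hr : 0 < r)
    (hT : ∀ y : A, vertexWeight r A y z ≠ 0 → y ∈ T) :
    r / 8 ≤ ∑ y ∈ T, vertexWeight r A y z := by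
  have hr8 : 0 < r / 8 := by positivity
  obtain ⟨x, -⟩ := hA.exists_dist_lt hr z
  obtain ⟨y, hy, hyz⟩ := (infDist_lt_iff (x := z) ⟨x, x.2⟩).1 (lt_add_of_pos_right _ hr8)
  rw [dist_comm] at hyz
  have hw : r / 8 ≤ vertexWeight r A y z := le_max_of_le_right (by linarith)
  exact hw.trans (Finset.single_le_sum (f := fun y : A => vertexWeight r A y z)
    (fun y _ => vertexWeight_nonneg r A y z) (hT ⟨y, hy⟩ (hr8.trans_le hw).ne'))

lemma IsDiscretization.extension_eq_of_mem_ball (hA : IsDiscretization r A) (hr : 0 < r)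
    (u : A → ℝ) {x : A} (hz : z ∈ ball (x : X) (r / 4)) : extension r A u z = u x := by
  have hT (y : A) (hy : vertexWeight r A y z ≠ 0) : y ∈ ({x} : Finset A) := by
    by_contra hyx
    have hsep := hA.prop x x.2 y y.2 fun h => hyx (Finset.mem_singleton.2 (Subtype.ext h.symm))
    have hzx : dist z x < r / 4 := hz
    linarith [dist_lt_infDist_add_of_vertexWeight_ne_zero hy, infDist_le_dist_of_mem x.2 (x := z),
      dist_triangle_right (x : X) y z, dist_comm (x : X) z]
  have hx : vertexWeight r A x z ≠ 0 := by
    have := hA.le_sum_vertexWeight hr hT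
    rw [Finset.sum_singleton] at this
    linarith
  exact (extension_eq_centerMass hT).trans (Finset.centerMass_singleton x u hx)

lemma MemDiscreteZero.ball_subset {Ω : Set X} (hu : MemDiscreteZero r A Ω u)
    {x : A} (hx : u x ≠ 0) : ball (x : X) (20 * r) ⊆ Ω :=
  not_not.1 fun h => hx (hu x h)

variable [MeasurableSpace X] [OpensMeasurableSpace X] {μ : Measure X} {D : ℝ≥0}

lemma exists_abs_extension_le (hμ : IsDoublingWith μ D) (hr : 0 < r) (hA : IsDiscretization r A)
    (u : A → ℝ) (z : X) : ∃ y : A, dist (y : X) z < 5 * r / 4 ∧ |extension r A u z| ≤ |u y| := by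
  have hfin := hA.prop.finite_dist_lt hμ hr z (5 * r / 4)
  have hT (y : A) (hy : vertexWeight r A y z ≠ 0) : y ∈ hfin.toFinset :=
    hfin.mem_toFinset.2 (hA.dist_lt_of_vertexWeight_ne_zero hr hy)
  have hpos := (show 0 < r / 8 by positivity).trans_le (hA.le_sum_vertexWeight hr hT)
  obtain ⟨y, hy, hle⟩ := convexOn_univ_norm.exists_ge_of_centerMass (p := u)
    (fun y _ => vertexWeight_nonneg r A y z) hpos fun _ _ => mem_univ _
  exact ⟨y, hfin.mem_toFinset.1 hy, by rwa [extension_eq_centerMass hT]⟩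

lemma exists_lipschitzOnWith_extension (hμ : IsDoublingWith μ D) (hr : 0 < r)
    (hA : IsDiscretization r A) (u : A → ℝ) (x : A) : ∃ c : ℝ≥0, c ≤ graphSlope r A u x ∧
      LipschitzOnWith (32 * D ^ 5 * c) (extension r A u) (ball x (3 * r / 2)) := by
  have hfin := hA.prop.finite_dist_lt hμ hr (x : X) (3 * r)
  set T := hfin.toFinset
  have hmem {y : A} : y ∈ T ↔ dist (y : X) x < 3 * r := hfin.mem_toFinset
  have hcard : (T.card : ℝ) ≤ D ^ 5 := by
    exact_mod_cast hA.prop.card_le (n := 5) hμ hr (fun y => hmem.1) (by linarith)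
  have hT {z : X} (hz : z ∈ ball (x : X) (3 * r / 2)) (y : A) (hy : vertexWeight r A y z ≠ 0) :
      y ∈ T := by
    have hyz := hA.dist_lt_of_vertexWeight_ne_zero hr hy
    exact hmem.2 (by linarith [dist_triangle (y : X) z x, mem_ball.1 hz])
  set c := T.sup fun y => (|u y - u x| / r).toNNReal
  have hc (y : A) (hy : y ∈ T) : |u y - u x| ≤ c * r :=
    (div_le_iff₀ hr).1 (Real.toNNReal_le_iff_le_coe.1
      (Finset.le_sup (f := fun y => (|u y - u x| / r).toNNReal) hy))
  have hosc (y : A) (hy : y ∈ T) (y' : A) (hy' : y' ∈ T) : ‖u y - u y'‖ ≤ 2 * (c * r) := by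
    rw [two_mul, ← dist_eq_norm]
    exact (dist_triangle_right _ _ _).trans (add_le_add (hc y hy) (hc y' hy'))
  refine ⟨c, ?_, LipschitzOnWith.of_dist_le_mul fun z hz z' hz' => ?_⟩
  · rw [ENNReal.coe_finset_sup]
    exact Finset.sup_le fun y hy => ofReal_le_graphSlope u (hmem.1 hy).le
  · rw [extension_eq_centerMass (hT hz), extension_eq_centerMass (hT hz'), dist_eq_norm]
    have hr8 : 0 < r / 8 := by positivity
    calc _ ≤ T.card * (2 * dist z z' * (2 * (c * r))) / (r / 8) :=
          norm_centerMass_sub_centerMass_le hr8 (hA.le_sum_vertexWeight hr (hT hz))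
            (fun y _ => vertexWeight_nonneg r A y z')
            (hr8.trans_le (hA.le_sum_vertexWeight hr (hT hz')))
            (fun y _ => abs_vertexWeight_sub_le r A y z z') hosc
      _ = 32 * T.card * c * dist z z' := by field_simp; ring
      _ ≤ 32 * D ^ 5 * c * dist z z' := by gcongr

lemma exists_mem_nhds_lipschitzOnWith_extension (hμ : IsDoublingWith μ D) (hr : 0 < r)
    (hA : IsDiscretization r A) (u : A → ℝ) (z : X) :
    ∃ c : ℝ≥0, ∃ U ∈ 𝓝 z, LipschitzOnWith c (extension r A u) U ∧
      ∀ p ∈ U, c ≤ (32 * D ^ 5) * vertexSup (3 * r / 2) (graphSlope r A u) p := by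
  obtain ⟨x, hx⟩ := hA.exists_dist_lt hr z
  obtain ⟨c, hc, hlip⟩ := exists_lipschitzOnWith_extension hμ hr hA u x
  refine ⟨_, _, isOpen_ball.mem_nhds (mem_ball'.2 (by linarith)), hlip, fun p hp => ?_⟩
  push_cast
  gcongr
  exact hc.trans (le_vertexSup _ hp)

lemma continuous_extension (hμ : IsDoublingWith μ D) (hr : 0 < r) (hA : IsDiscretization r A)
    (u : A → ℝ) : Continuous (extension r A u) := by
  refine continuous_iff_continuousAt.2 fun z => ?_
  obtain ⟨_, _, hU, hlip, -⟩ := exists_mem_nhds_lipschitzOnWith_extension hμ hr hA u z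
  exact hlip.continuousOn.continuousAt hU

lemma isUpperGradient_extension (hμ : IsDoublingWith μ D) (hr : 0 < r)
    (hA : IsDiscretization r A) (u : A → ℝ) : IsUpperGradient (extension r A u)
      fun z => (32 * D ^ 5) * vertexSup (3 * r / 2) (graphSlope r A u) z :=
  ⟨(measurable_vertexSup _ _).const_mul _,
    upperGradientIneq_of_locallyLipschitz (exists_mem_nhds_lipschitzOnWith_extension hμ hr hA u)⟩

lemma ballAverage_extension (hμ : IsDoublingWith μ D) (hr : 0 < r) (hA : IsDiscretization r A)
    (u : A → ℝ) (x : A) : ballAverage μ r A (extension r A u) x = u x := by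
  have hr4 : 0 < r / 4 := by positivity
  rw [ballAverage, setAverage_congr_fun measurableSet_ball
    (Eventually.of_forall fun z hz => hA.extension_eq_of_mem_ball hr u hz)]
  exact setAverage_const (hμ.measure_ball_pos x hr4).ne' (hμ.measure_ball_lt_top x hr4).ne _

end Extension

section NewtonSobolev

variable {X : Type*} [MetricSpace X] [MeasurableSpace X] {μ : Measure X} {p : ℝ}

lemma modulus_empty (hp : 0 < p) (μ : Measure X) : modulus p μ ∅ = 0 := by
  refine le_antisymm ((iInf₂_le (fun _ => 0) ⟨measurable_const, by simp⟩).trans ?_) zero_le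
  simp [ENNReal.zero_rpow_of_pos hp]

lemma IsUpperGradient.isWeakUpperGradient {f : X → ℝ} {g : X → ℝ≥0∞} (hg : IsUpperGradient f g)
    (hp : 0 < p) (μ : Measure X) : IsWeakUpperGradient p μ f g :=
  ⟨hg.1, ∅, modulus_empty hp μ, fun γ _ => hg.2 γ⟩

lemma IsMinimalWeakUpperGradient.lintegral_rpow_le_upperGradientEnergy {f : X → ℝ} {g : X → ℝ≥0∞}
    (hg : IsMinimalWeakUpperGradient p μ f g) (hp : 0 < p) :
    ∫⁻ x, g x ^ p ∂μ ≤ upperGradientEnergy p μ f := by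
  refine le_iInf₂ fun h hh => ?_
  rcases eq_or_ne (∫⁻ x, h x ^ p ∂μ) ∞ with htop | htop
  · exact le_top.trans_eq htop.symm
  · refine lintegral_mono_ae ?_
    filter_upwards [hg.2.2 h (hh.isWeakUpperGradient hp μ) htop.lt_top] with x hx
    gcongr

lemma capacity_empty (hp : 0 < p) (μ : Measure X) : capacity p μ ∅ = 0 := by
  have hgrad : IsUpperGradient (fun _ : X => (0 : ℝ)) fun _ => 0 :=
    ⟨measurable_const, fun γ => by simp [UpperGradientIneq]⟩
  have henergy : upperGradientEnergy p μ (fun _ : X => 0) = 0 :=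
    le_antisymm ((iInf₂_le _ hgrad).trans (by simp [ENNReal.zero_rpow_of_pos hp])) zero_le
  refine le_antisymm ((iInf₂_le (fun _ => 0) ⟨aemeasurable_const, by simp⟩).trans ?_) zero_le
  simp [ENNReal.zero_rpow_of_pos hp, henergy]

variable [OpensMeasurableSpace X] {r : ℝ} {A : Set X} {u : A → ℝ} {D : ℝ≥0}

lemma upperGradientEnergy_extension_le (hμ : IsDoublingWith μ D) (hr : 0 < r)
    (hA : IsDiscretization r A) (u : A → ℝ) :
    upperGradientEnergy 2 μ (extension r A u) ≤
      ((32 * D ^ 5) ^ 2 * D ^ 3 : ℝ≥0) * graphEnergy μ r A u := by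
  have := hA.prop.countable hμ hr
  calc upperGradientEnergy 2 μ (extension r A u)
      ≤ ∫⁻ z, (32 * D ^ 5 * vertexSup (3 * r / 2) (graphSlope r A u) z) ^ (2 : ℝ) ∂μ :=
        iInf₂_le _ (isUpperGradient_extension hμ hr hA u)
    _ = (32 * D ^ 5) ^ 2 * ∫⁻ z, vertexSup (3 * r / 2) (graphSlope r A u) z ^ (2 : ℝ) ∂μ := by
        simp_rw [ENNReal.mul_rpow_of_nonneg (32 * (D : ℝ≥0∞) ^ 5) _ zero_le_two]
        rw [lintegral_const_mul _ ((measurable_vertexSup _ _).pow_const _), ENNReal.rpow_two]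
    _ ≤ (32 * D ^ 5) ^ 2 * (D ^ 3 * graphEnergy μ r A u) := by
        gcongr
        refine (lintegral_vertexSup_rpow_le hμ hr (n := 3) (by linarith) _ two_pos).trans ?_
        gcongr
        exact lintegral_graphSlope_sq_le μ hr.le u
    _ = ((32 * D ^ 5) ^ 2 * D ^ 3 : ℝ≥0) * graphEnergy μ r A u := by
        push_cast
        rw [mul_assoc]

lemma ofReal_abs_extension_le_vertexSup (hμ : IsDoublingWith μ D) (hr : 0 < r)
    (hA : IsDiscretization r A) (u : A → ℝ) (z : X) :
    ENNReal.ofReal |extension r A u z| ≤ vertexSup (5 * r) (fun x => ‖u x‖ₑ) z := by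
  obtain ⟨y, hyz, hle⟩ := exists_abs_extension_le hμ hr hA u z
  calc ENNReal.ofReal |extension r A u z| ≤ ENNReal.ofReal |u y| := ENNReal.ofReal_le_ofReal hle
    _ = ‖u y‖ₑ := (Real.enorm_eq_ofReal_abs _).symm
    _ ≤ vertexSup (5 * r) (fun x => ‖u x‖ₑ) z :=
        le_vertexSup (fun x => ‖u x‖ₑ) (by linarith [dist_comm z y])

lemma memNewtonSobolev_extension (hμ : IsDoublingWith μ D) (hr : 0 < r)
    (hA : IsDiscretization r A) (hp : 0 < p)
    (hu : ∫⁻ x, ‖u x‖ₑ ^ p ∂discreteMeasure μ r A < ∞) :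
    MemNewtonSobolev p μ (extension r A u) := by
  have := hA.prop.countable hμ hr
  have hsup : ∫⁻ z, vertexSup (5 * r) (fun x => ‖u x‖ₑ) z ^ p ∂μ < ∞ :=
    (lintegral_vertexSup_rpow_le hμ hr (n := 5) (by linarith) _ hp).trans_lt
      (ENNReal.mul_lt_top (ENNReal.pow_lt_top ENNReal.coe_lt_top) hu)
  have hpow (a : ℝ≥0∞) (ha : a < ∞) : a ^ (1 / p) < ∞ :=
    ENNReal.rpow_lt_top_of_nonneg (by positivity) ha.ne
  refine ⟨(continuous_extension hμ hr hA u).aemeasurable, ENNReal.add_lt_top.2 ⟨?_, ?_⟩⟩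
  · refine hpow _ (hsup.trans_le' (lintegral_mono fun z => ?_))
    gcongr
    exact ofReal_abs_extension_le_vertexSup hμ hr hA u z
  · refine (iInf₂_le _ (isUpperGradient_extension hμ hr hA u)).trans_lt (hpow _ ?_)
    let K : ℝ≥0∞ := 32 * D ^ 5 * (2 / ENNReal.ofReal r)
    have hK : K < ∞ :=
      ENNReal.mul_lt_top (ENNReal.mul_lt_top (by simp) (ENNReal.pow_lt_top ENNReal.coe_lt_top))
        (ENNReal.div_lt_top (by simp) (by simpa using hr))
    calc ∫⁻ z, (32 * D ^ 5 * vertexSup (3 * r / 2) (graphSlope r A u) z) ^ p ∂μ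
        ≤ ∫⁻ z, (K * vertexSup (5 * r) (fun x => ‖u x‖ₑ) z) ^ p ∂μ := by
          refine lintegral_mono fun z => ENNReal.rpow_le_rpow ?_ hp.le
          exact (mul_le_mul_right (vertexSup_graphSlope_le hr u z) _).trans_eq
            (mul_assoc _ _ _).symm
      _ = K ^ p * ∫⁻ z, vertexSup (5 * r) (fun x => ‖u x‖ₑ) z ^ p ∂μ := by
          simp_rw [ENNReal.mul_rpow_of_nonneg _ _ hp.le]
          exact lintegral_const_mul _ ((measurable_vertexSup _ _).pow_const _)
      _ < ∞ := ENNReal.mul_lt_top (ENNReal.rpow_lt_top_of_nonneg hp.le hK.ne) hsup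

variable {Ω : Set X}

lemma MemDiscreteZero.finite_support (hu : MemDiscreteZero r A Ω u) (hμ : IsDoublingWith μ D)
    (hr : 0 < r) (hA : IsSeparatedSet r A) (hΩ : Bornology.IsBounded Ω) :
    (Function.support u).Finite := by
  rcases isEmpty_or_nonempty X with _ | ⟨⟨z⟩⟩
  · exact toFinite _
  obtain ⟨R, hR⟩ := hΩ.subset_ball z
  exact (hA.finite_dist_lt hμ hr z R).subset fun x hx =>
    hR (hu.ball_subset hx (mem_ball_self (by positivity)))

lemma lintegral_enorm_rpow_lt_top_of_finite_support (hμ : IsDoublingWith μ D) (hr : 0 < r)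
    (hp : 0 < p) (hu : (Function.support u).Finite) :
    ∫⁻ x, ‖u x‖ₑ ^ p ∂discreteMeasure μ r A < ∞ := by
  rw [lintegral_discreteMeasure, tsum_eq_sum (s := hu.toFinset)]
  · exact ENNReal.sum_lt_top.2 fun x _ => ENNReal.mul_lt_top
      (ENNReal.rpow_lt_top_of_nonneg hp.le enorm_ne_top)
      (hμ.measure_ball_lt_top x (by positivity))
  · intro x hx
    simp [Function.notMem_support.1 (mt hu.mem_toFinset.2 hx), hp]

lemma MemDiscreteZero.extension_eq_zero (hu : MemDiscreteZero r A Ω u) (hμ : IsDoublingWith μ D)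
    (hr : 0 < r) (hA : IsDiscretization r A) {z : X} (hz : z ∉ Ω) : extension r A u z = 0 := by
  obtain ⟨y, hyz, hle⟩ := exists_abs_extension_le hμ hr hA u z
  have hy : u y = 0 := not_not.1 fun hy =>
    hz (hu.ball_subset hy (mem_ball'.2 (by linarith)))
  rwa [hy, abs_zero, abs_nonpos_iff] at hle

lemma memNewtonSobolevZero_extension (hμ : IsDoublingWith μ D) (hr : 0 < r)
    (hA : IsDiscretization r A) (hp : 0 < p) (hΩ : Bornology.IsBounded Ω)
    (hu : MemDiscreteZero r A Ω u) : MemNewtonSobolevZero p μ Ω (extension r A u) := by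
  have hempty : {z | z ∉ Ω ∧ extension r A u z ≠ 0} = ∅ :=
    eq_empty_of_forall_notMem fun z hz => hz.2 (hu.extension_eq_zero hμ hr hA hz.1)
  refine ⟨memNewtonSobolev_extension hμ hr hA hp ?_, hempty ▸ capacity_empty hp μ⟩
  exact lintegral_enorm_rpow_lt_top_of_finite_support hμ hr hp
    (hu.finite_support hμ hr hA.prop hΩ)

end NewtonSobolev

end GraphApprox

open GraphApprox in
theorem theorem1p2_general {X : Type*} [MetricSpace X] [MeasurableSpace X] [OpensMeasurableSpace X]
    (μ : Measure X) (hμ : IsDoubling μ) :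
    ∃ C : ℝ, 1 ≤ C ∧ ∀ r : ℝ, 0 < r → ∀ A : Set X, IsDiscretization r A →
      ∃ P : (A → ℝ) → (X → ℝ),
        (∀ u, MemLp u 2 (discreteMeasure μ r A) → MemNewtonSobolev 2 μ (P u)) ∧
        (∀ u, LocallyIntegrable (P u) μ ∧ ∀ x, ballAverage μ r A (P u) x = u x) ∧
        (∀ u, upperGradientEnergy 2 μ (P u) ≤ ENNReal.ofReal C * graphEnergy μ r A u ∧
          ∀ g, IsMinimalWeakUpperGradient 2 μ (P u) g →
            ∫⁻ x, g x ^ (2 : ℝ) ∂μ ≤ ENNReal.ofReal C * graphEnergy μ r A u) ∧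
        ∀ Ω, Bornology.IsBounded Ω → ∀ u, MemDiscreteZero r A Ω u →
          MemNewtonSobolevZero 2 μ Ω (P u) := by
  obtain ⟨D, hD⟩ := hμ.exists_isDoublingWith
  have := hD.isLocallyFiniteMeasure
  set K := (32 * D ^ 5) ^ 2 * D ^ 3
  refine ⟨max 1 K, le_max_left _ _, fun r hr A hA => ⟨extension r A, fun u hu => ?_,
    fun u => ⟨(continuous_extension hD hr hA u).locallyIntegrable,
      ballAverage_extension hD hr hA u⟩,
    fun u => ?_, fun Ω hΩ u hu => memNewtonSobolevZero_extension hD hr hA two_pos hΩ hu⟩⟩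
  · refine memNewtonSobolev_extension hD hr hA two_pos ?_
    exact lintegral_rpow_enorm_lt_top_of_eLpNorm_lt_top two_ne_zero ENNReal.ofNat_ne_top hu.2
  · have henergy : upperGradientEnergy 2 μ (extension r A u) ≤
        ENNReal.ofReal (max 1 K) * graphEnergy μ r A u :=
      (upperGradientEnergy_extension_le hD hr hA u).trans (mul_le_mul_left
        (ENNReal.ofReal_coe_nnreal.symm.trans_le (ENNReal.ofReal_le_ofReal (le_max_right _ _))) _)
    exact ⟨henergy, fun g hg => (hg.lintegral_rpow_le_upperGradientEnergy two_pos).trans henergy⟩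

theorem theorem1p2 {X : Type*} [MetricSpace X] [CompleteSpace X] [MeasurableSpace X] [BorelSpace X]
    (μ : MeasureTheory.Measure X) (hμ : GraphApprox.IsDoubling μ)
    (hP : GraphApprox.SupportsPoincare 2 μ)
    (Ω : Set X) (hΩo : IsOpen Ω) (hΩc : IsConnected Ω) (hΩb : Bornology.IsBounded Ω)
    (hΩ : 0 < μ Ωᶜ) :
    ∃ C : ℝ, 1 ≤ C ∧ ∀ r : ℝ, 0 < r → ∀ Xr : Set X, GraphApprox.IsDiscretization r Xr →
      ∃ P : (Xr → ℝ) → (X → ℝ),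
        -- `P` maps `L²(X_r)` to `N^{1,2}(X)`
        (∀ u : Xr → ℝ, MeasureTheory.MemLp u 2 (GraphApprox.discreteMeasure μ r Xr) →
          GraphApprox.MemNewtonSobolev 2 μ (P u)) ∧
        -- (a), for every function on `X_r`
        (∀ u : Xr → ℝ, MeasureTheory.LocallyIntegrable (P u) μ ∧
          ∀ x : Xr, GraphApprox.ballAverage μ r Xr (P u) x = u x) ∧
        -- (b), for the infimum over upper gradients and for the minimal 2-weak upper gradient
        (∀ u : Xr → ℝ,
          GraphApprox.upperGradientEnergy 2 μ (P u) ≤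
            ENNReal.ofReal C * GraphApprox.graphEnergy μ r Xr u ∧
          ∀ g : X → ENNReal, GraphApprox.IsMinimalWeakUpperGradient 2 μ (P u) g →
            ∫⁻ x, g x ^ (2 : ℝ) ∂μ ≤ ENNReal.ofReal C * GraphApprox.graphEnergy μ r Xr u) ∧
        -- (c)
        (∀ u : Xr → ℝ, GraphApprox.MemDiscreteZero r Xr Ω u →
          GraphApprox.MemNewtonSobolevZero 2 μ Ω (P u)) := by
  obtain ⟨C, hC, h⟩ := theorem1p2_general μ hμ
  refine ⟨C, hC, fun r hr A hA => ?_⟩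
  obtain ⟨P, hP₂, ha, hb, hc⟩ := h r hr A hA
  exact ⟨P, hP₂, ha, hb, hc Ω hΩb⟩
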